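/- For $N\in\mathbb N$ let $C(S^{N-1}_{\mathbb R,+})$ be the universal (unital) $C^*$-algebra generated by elements $x_1,\ldots,x_N$ subject to $x_i=x_i^*$ and $\sum_i x_i^2=1$; the noncommutative compact space $S^{N-1}_{\mathbb R,+}$ is called the free sphere. A closed subspace $S\subset S^{N-1}_{\mathbb R,+}$ is a quotient $C(S)$ of this algebra by a closed two-sided ideal, and two closed subspaces are equal when their ideals are equal. The subspace obtained by imposing a family of relations $a_r=b_r$ is the one whose ideal is the closed two-sided ideal generated by the elements $a_r-b_r$. The half-liberated sphere $S^{N-1}_{\mathbb R,*}$ is obtained by imposing $x_ix_jx_k=x_kx_jx_i$ for all $i,j,k$. The real sphere $S^{N-1}_{\mathbb R}=\{p\in\mathbb R^N\mid\sum_ip_i^2=1\}$ is regarded as a closed subspace through the morphism $C(S^{N-1}_{\mathbb R,+})\to C(S^{N-1}_{\mathbb R})$ which sends $x_i$ to the $i$-th coordinate function. A monomial sphere is a closed subspace of $S^{N-1}_{\mathbb R,+}$ obtained by imposing, for all $\sigma$ in some set $E\subset\bigsqcup_{k\ge0}S_k$, the relations $$x_{i_1}\cdots x_{i_k}=x_{i_{\sigma(1)}}\cdots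 x_{i_{\sigma(k)}}\qquad\text{for all }(i_1,\ldots,i_k)\in\{1,\ldots,N\}^k,$$ where $k$ is such that $\sigma\in S_k$. Let $S_\infty=\bigcup_kS_k$, with $S_k\subset S_{k+1}$ given by $\sigma(k+1)=k+1$. A filtered subgroup of $S_\infty$ is a subgroup $G$ such that, with $G_k=G\cap S_k$, the concatenation of any $\sigma\in G_k$ and $\pi\in G_l$ (the permutation in $S_{k+l}$ acting as $\sigma$ on the first $k$ points and as $\pi$ on the last $l$ points) belongs to $G_{k+l}$. Let $S_\infty^*\subset S_\infty$ be the subgroup of the permutations such that $\sigma(i)$ and $i$ have the same parity for all $i$. Represent $\sigma\in S_k$ by the diagram with strings joining the upper point $i$ to the lower point $\sigma(i)$, $1\le i\le k$. Say that $G$ is stable under removing outer strings if, for any $\sigma\in G_k$ with $\sigma(1)=1$ (respectively $\sigma(k)=k$), the permutation in $S_{k-1}$ obtained by deleting the string at $1$ (respectively at $k$) belongs to $G_{k-1}$; and that $G$ is stable under removing neighbouring strings if, for any $\sigma\in G_k$ and any $p<k$ with $|\sigma(p)-\sigma(p+1)|=1$, the permutation in $S_{k-2}$ obtained by deleting the strings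 at $p$ and $p+1$ belongs to $G_{k-2}$. **Theorem 2.8.** 1. For any $N$, a closed subspace of $S^{N-1}_{\mathbb R,+}$ is a monomial sphere if and only if it is one of the three spheres $S^{N-1}_{\mathbb R}\subset S^{N-1}_{\mathbb R,*}\subset S^{N-1}_{\mathbb R,+}$. 2. A filtered subgroup $G\subset S_\infty$ is stable under removing outer strings and under removing neighbouring strings if and only if $G$ is one of $\{1\}$, $S_\infty^*$, $S_\infty$. -/

import Mathlib

open scoped ENNReal

noncomputable section

namespace MonomialSphere

/-! ### The free sphere -/

/-- A family `x₁, …, x_N` of self-adjoint elements with `∑ xᵢ² = 1` in a (nonzero) unital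
C⋆-algebra. -/
structure SphereModel (N : ℕ) : Type 1 where
  /-- the C⋆-algebra -/
  B : Type
  [cstar : CStarAlgebra B]
  [nontriv : Nontrivial B]
  /-- the coordinates -/
  x : Fin N → B
  selfAdjoint : ∀ i, star (x i) = x i
  sum_sq : ∑ i, x i ^ 2 = 1

attribute [instance] SphereModel.cstar SphereModel.nontriv

/-- The `ℓ^∞`-product of all the models. -/
abbrev ModelProduct (N : ℕ) : Type 1 := lp (fun ρ : SphereModel N => ρ.B) ∞

instance (N : ℕ) : CStarAlgebra (ModelProduct N) where

/-- In any model, the coordinates have norm at most `1`. -/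
theorem SphereModel.norm_x_le {N : ℕ} (ρ : SphereModel N) (i : Fin N) : ‖ρ.x i‖ ≤ 1 := by
  let _ := CStarAlgebra.spectralOrder ρ.B
  have _ := CStarAlgebra.spectralOrderedRing ρ.B
  have hnn : ∀ j, 0 ≤ ρ.x j ^ 2 := fun j => by
    have h := star_mul_self_nonneg (ρ.x j)
    rwa [ρ.selfAdjoint j, ← pow_two] at h
  have hle : ρ.x i ^ 2 ≤ 1 := by
    rw [← ρ.sum_sq]
    exact Finset.single_le_sum (f := fun j => ρ.x j ^ 2) (fun j _ => hnn j) (Finset.mem_univ i)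
  have h1 : ‖ρ.x i ^ 2‖ ≤ 1 := by
    have h := CStarAlgebra.norm_le_norm_of_nonneg_of_le (hnn i) hle
    rwa [norm_one] at h
  have h2 : ‖ρ.x i ^ 2‖ = ‖ρ.x i‖ * ‖ρ.x i‖ := by
    rw [pow_two]
    nth_rewrite 1 [← ρ.selfAdjoint i]
    exact CStarRing.norm_star_mul_self
  nlinarith [norm_nonneg (ρ.x i)]

/-- The universal coordinates: the tuples of the `i`-th coordinates in all models. -/
def universalCoord (N : ℕ) (i : Fin N) : ModelProduct N :=
  ⟨fun ρ => ρ.x i, memℓp_infty ⟨1, by rintro _ ⟨ρ, rfl⟩; exact ρ.norm_x_le i⟩⟩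

/-- `C(S^{N-1}_{ℝ,+})`, the universal C⋆-algebra generated by self-adjoint elements `x₁, …, x_N`
with `∑ xᵢ² = 1`. It is the C⋆-algebra generated by the universal coordinates, so that the norm of
a ⋆-polynomial in the coordinates is the supremum of its norms in all models, that is, the biggest
C⋆-norm. (A C⋆-algebra generated by `N` elements is separable, so it has at most continuum many
elements, and models with `B : Type` exhaust all models up to isomorphism.) -/
abbrev FreeSphereAlg (N : ℕ) : Type 1 :=
  (StarAlgebra.adjoin ℂ (Set.range (universalCoord N))).topologicalClosure

instance (N : ℕ) : IsClosed
    (((StarAlgebra.adjoin ℂ (Set.range (universalCoord N))).topologicalClosure :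
      StarSubalgebra ℂ (ModelProduct N)) : Set (ModelProduct N)) :=
  StarSubalgebra.isClosed_topologicalClosure _

instance (N : ℕ) : CStarAlgebra (FreeSphereAlg N) := StarSubalgebra.cstarAlgebra _

/-- The standard coordinates `x₁, …, x_N ∈ C(S^{N-1}_{ℝ,+})`. -/
def coord {N : ℕ} (i : Fin N) : FreeSphereAlg N :=
  ⟨universalCoord N i, StarSubalgebra.le_topologicalClosure _
    (StarAlgebra.subset_adjoin ℂ _ ⟨i, rfl⟩)⟩

/-- The canonical unital ⋆-homomorphism `C(S^{N-1}_{ℝ,+}) → B` to a model, `xᵢ ↦ xᵢ`. -/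
def evalModel {N : ℕ} (ρ : SphereModel N) : FreeSphereAlg N →⋆ₐ[ℂ] ρ.B where
  toFun a := (a : ModelProduct N) ρ
  map_one' := rfl
  map_mul' _ _ := rfl
  map_zero' := rfl
  map_add' _ _ := rfl
  commutes' _ := rfl
  map_star' _ := rfl

theorem evalModel_coord {N : ℕ} (ρ : SphereModel N) (i : Fin N) :
    evalModel ρ (coord i) = ρ.x i := rfl

/-- The relations of the free sphere hold for the standard coordinates. -/
theorem star_coord {N : ℕ} (i : Fin N) : star (coord i) = coord i := by
  apply Subtype.ext
  apply lp.ext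
  funext ρ
  exact ρ.selfAdjoint i

theorem sum_coord_sq (N : ℕ) : ∑ i : Fin N, coord i ^ 2 = (1 : FreeSphereAlg N) := by
  apply Subtype.ext
  apply lp.ext
  funext ρ
  have h : evalModel ρ (∑ i : Fin N, coord i ^ 2) = evalModel ρ 1 := by
    rw [map_sum, map_one, ← ρ.sum_sq]
    exact Finset.sum_congr rfl fun i _ => by rw [map_pow, evalModel_coord]
  exact h

theorem continuous_evalModel {N : ℕ} (ρ : SphereModel N) : Continuous (evalModel ρ) := by
  refine AddMonoidHomClass.continuous_of_bound (evalModel ρ) 1 fun a => ?_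
  rw [one_mul]
  exact lp.norm_apply_le_norm ENNReal.top_ne_zero (a : ModelProduct N) ρ

/-- Universality: `evalModel ρ` is the only ⋆-homomorphism respecting the coordinates. -/
theorem eq_evalModel {N : ℕ} (ρ : SphereModel N) (φ : FreeSphereAlg N →⋆ₐ[ℂ] ρ.B)
    (h : ∀ i, φ (coord i) = ρ.x i) : φ = evalModel ρ := by
  refine StarAlgHom.ext_topologicalClosure
    (AddMonoidHomClass.continuous_of_bound φ 1 fun a => by
      rw [one_mul]; exact NonUnitalStarAlgHom.norm_apply_le φ a)
    (continuous_evalModel ρ) ?_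
  refine StarAlgHom.ext_adjoin fun a ha => ?_
  obtain ⟨i, hi⟩ := ha
  have ha' : StarSubalgebra.inclusion (StarSubalgebra.le_topologicalClosure _) a = coord i :=
    Subtype.ext hi.symm
  change φ (StarSubalgebra.inclusion (StarSubalgebra.le_topologicalClosure _) a) =
    evalModel ρ (StarSubalgebra.inclusion (StarSubalgebra.le_topologicalClosure _) a)
  rw [ha', h, evalModel_coord]

/-! ### Closed subspaces of the free sphere -/

/-- A closed subspace `S ⊂ S^{N-1}_{ℝ,+}`, that is, a quotient C⋆-algebra `C(S)` of
`C(S^{N-1}_{ℝ,+})`, given by its kernel, a closed two-sided ideal (such an ideal of a C⋆-algebra is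
automatically stable under `⋆`). -/
@[ext]
structure ClosedSubspace (N : ℕ) : Type 1 where
  /-- the kernel of `C(S^{N-1}_{ℝ,+}) → C(S)` -/
  ideal : TwoSidedIdeal (FreeSphereAlg N)
  isClosed : IsClosed (ideal : Set (FreeSphereAlg N))

/-- The closed subspace obtained by imposing the relations `a = b`, for `(a, b) ∈ R`: its ideal is
the smallest closed two-sided ideal containing all the elements `a - b`. -/
def cutOut {N : ℕ} (R : Set (FreeSphereAlg N × FreeSphereAlg N)) : ClosedSubspace N where
  ideal := sInf {I | IsClosed (I : Set (FreeSphereAlg N)) ∧ ∀ r ∈ R, r.1 - r.2 ∈ I}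
  isClosed := by
    have h : ((sInf {I : TwoSidedIdeal (FreeSphereAlg N) |
        IsClosed (I : Set (FreeSphereAlg N)) ∧ ∀ r ∈ R, r.1 - r.2 ∈ I} :
          TwoSidedIdeal (FreeSphereAlg N)) : Set (FreeSphereAlg N)) =
        ⋂ I ∈ {I : TwoSidedIdeal (FreeSphereAlg N) |
          IsClosed (I : Set (FreeSphereAlg N)) ∧ ∀ r ∈ R, r.1 - r.2 ∈ I},
          (I : Set (FreeSphereAlg N)) := by
      ext a
      simp only [Set.mem_iInter, SetLike.mem_coe]
      exact TwoSidedIdeal.mem_sInf _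
    rw [h]
    exact isClosed_biInter fun I hI => hI.1

/-! ### The three spheres -/

/-- The free sphere `S^{N-1}_{ℝ,+}`, as a subspace of itself. -/
def freeSphere (N : ℕ) : ClosedSubspace N where
  ideal := ⊥
  isClosed := by
    rw [TwoSidedIdeal.coe_bot]
    exact isClosed_singleton

/-- The half-liberated sphere `S^{N-1}_{ℝ,*}`: the relations are `xᵢxⱼxₖ = xₖxⱼxᵢ`. -/
def halfLiberatedSphere (N : ℕ) : ClosedSubspace N :=
  cutOut {r | ∃ i j k : Fin N,
    r = (coord i * coord j * coord k, coord k * coord j * coord i)}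

/-- The points `p ∈ ℝ^N` with `∑ pᵢ² = 1`. -/
abbrev RealPoint (N : ℕ) : Type := {p : Fin N → ℝ // ∑ i, p i ^ 2 = 1}

/-- A point of the usual sphere, seen as a model of the coordinates in `ℂ`. -/
def pointModel {N : ℕ} (p : RealPoint N) : SphereModel N where
  B := ℂ
  x i := (p.1 i : ℂ)
  selfAdjoint i := Complex.conj_ofReal (p.1 i)
  sum_sq := by exact_mod_cast congrArg (fun t : ℝ => (t : ℂ)) p.2

/-- The usual sphere `S^{N-1}_ℝ = {p ∈ ℝ^N | ∑ pᵢ² = 1}`, as a closed subspace of the free sphere.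
The ideal is the kernel of the restriction map `C(S^{N-1}_{ℝ,+}) → C(S^{N-1}_ℝ)`, `xᵢ ↦ (p ↦ pᵢ)`,
and consists of the elements which vanish at all points of the usual sphere. -/
def realSphere (N : ℕ) : ClosedSubspace N where
  ideal := ⨅ p : RealPoint N, TwoSidedIdeal.ker (evalModel (pointModel p))
  isClosed := by
    have h : ((⨅ p : RealPoint N, TwoSidedIdeal.ker (evalModel (pointModel p)) :
        TwoSidedIdeal (FreeSphereAlg N)) : Set (FreeSphereAlg N)) =
        ⋂ p : RealPoint N, evalModel (pointModel p) ⁻¹' {0} := by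
      ext a
      simp only [Set.mem_iInter, SetLike.mem_coe, Set.mem_preimage, Set.mem_singleton_iff]
      refine (TwoSidedIdeal.mem_iInf _).trans (forall_congr' fun p => ?_)
      exact TwoSidedIdeal.mem_ker (evalModel (pointModel p))
    rw [h]
    exact isClosed_iInter fun p => isClosed_singleton.preimage (continuous_evalModel _)

/-! ### Monomial spheres -/

/-- The monomial `x_{i₁} ⋯ x_{iₖ}`. -/
def monomial {N k : ℕ} (i : Fin k → Fin N) : FreeSphereAlg N :=
  (List.ofFn fun j => coord (i j)).prod

/-- The relations `x_{i₁} ⋯ x_{iₖ} = x_{i_{σ(1)}} ⋯ x_{i_{σ(k)}}`, for all indices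
`(i₁, …, iₖ)`. -/
def permRelations (N : ℕ) {k : ℕ} (σ : Equiv.Perm (Fin k)) :
    Set (FreeSphereAlg N × FreeSphereAlg N) :=
  {r | ∃ i : Fin k → Fin N, r = (monomial i, monomial fun j => i (σ j))}

/-- A monomial sphere is a closed subspace of the free sphere obtained by imposing the relations
associated to certain permutations, of variable size. -/
def IsMonomialSphere {N : ℕ} (S : ClosedSubspace N) : Prop :=
  ∃ E : Set (Σ k : ℕ, Equiv.Perm (Fin k)), S = cutOut (⋃ σ ∈ E, permRelations N σ.2)

/-! ### Filtered subgroups of `S_∞` -/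

/-- Concatenation `S_k × S_l → S_{k+l}`: the diagram of `σ` followed, at right, by that of `π`. -/
def concat {k l : ℕ} (σ : Equiv.Perm (Fin k)) (π : Equiv.Perm (Fin l)) :
    Equiv.Perm (Fin (k + l)) :=
  finSumFinEquiv.permCongr (Equiv.Perm.sumCongr σ π)

/-- A filtered subgroup `G ⊂ S_∞`, where `S_∞ = ⋃ S_k` with `S_k ⊂ S_{k+1}` by adding a fixed point
at right. It is written `G = (G_k)`, with `G_k = G ∩ S_k` (this is `mem_succ_iff`), and has to be
stable under concatenation. -/
@[ext]
structure FilteredSubgroup where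
  /-- the component `G_k ⊂ S_k` -/
  level : ∀ k : ℕ, Subgroup (Equiv.Perm (Fin k))
  mem_succ_iff : ∀ {k : ℕ} (σ : Equiv.Perm (Fin k)),
    concat σ (1 : Equiv.Perm (Fin 1)) ∈ level (k + 1) ↔ σ ∈ level k
  concat_mem : ∀ {k l : ℕ} {σ : Equiv.Perm (Fin k)} {π : Equiv.Perm (Fin l)},
    σ ∈ level k → π ∈ level l → concat σ π ∈ level (k + l)

theorem concat_castAdd {k l : ℕ} (σ : Equiv.Perm (Fin k)) (π : Equiv.Perm (Fin l)) (i : Fin k) :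
    concat σ π (Fin.castAdd l i) = Fin.castAdd l (σ i) := by
  simp [concat, Equiv.permCongr_apply]

theorem concat_natAdd {k l : ℕ} (σ : Equiv.Perm (Fin k)) (π : Equiv.Perm (Fin l)) (i : Fin l) :
    concat σ π (Fin.natAdd k i) = Fin.natAdd k (π i) := by
  simp [concat, Equiv.permCongr_apply]

/-- The trivial filtered subgroup `{1}`. -/
def trivialGroup : FilteredSubgroup where
  level _ := ⊥
  mem_succ_iff {k} σ := by
    simp only [Subgroup.mem_bot]
    constructor
    · intro h
      ext i
      have := concat_castAdd σ (1 : Equiv.Perm (Fin 1)) i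
      rw [h] at this
      simpa using (congrArg Fin.val this).symm
    · rintro rfl
      ext i
      refine Fin.addCases (fun i => ?_) (fun i => ?_) i
      · rw [concat_castAdd]; rfl
      · rw [concat_natAdd]; rfl
  concat_mem {k l σ π} hσ hπ := by
    simp only [Subgroup.mem_bot] at *
    subst hσ hπ
    ext i
    refine Fin.addCases (fun i => ?_) (fun i => ?_) i
    · rw [concat_castAdd]; rfl
    · rw [concat_natAdd]; rfl

/-- The full group `S_∞`. -/
def fullGroup : FilteredSubgroup where
  level _ := ⊤
  mem_succ_iff _ := by simp
  concat_mem _ _ := Subgroup.mem_top _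

/-- The group `S_∞^*`. When the upper legs are labelled `∘•∘•…` and the lower legs `•∘•∘…`, each
string must join a black leg to a white leg, which means that `σ(i)` and `i` have the same
parity. -/
def parityGroup : FilteredSubgroup where
  level k :=
    { carrier := {σ | ∀ i : Fin k, (σ i).val % 2 = i.val % 2}
      mul_mem' := fun {σ π} hσ hπ i => (hσ (π i)).trans (hπ i)
      one_mem' := fun _ => rfl
      inv_mem' := fun {σ} hσ i => by
        have h := hσ (σ⁻¹ i)
        have e : σ (σ⁻¹ i) = i := σ.apply_symm_apply i
        rw [e] at h
        exact h.symm }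
  mem_succ_iff {k} σ := by
    constructor
    · intro h i
      have h' := h (Fin.castAdd 1 i)
      rw [concat_castAdd] at h'
      simpa using h'
    · intro h i
      refine Fin.addCases (fun i => ?_) (fun i => ?_) i
      · rw [concat_castAdd]; simpa using h i
      · rw [concat_natAdd]; rfl
  concat_mem {k l σ π} hσ hπ := by
    intro i
    refine Fin.addCases (fun i => ?_) (fun i => ?_) i
    · rw [concat_castAdd]; simpa using hσ i
    · rw [concat_natAdd]
      have h := hπ i
      simp only [Fin.val_natAdd]
      omega

/-- `σ` is obtained from the diagram of `τ` by removing the string which starts at the upper leg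
`p` and ends at the lower leg `τ p`. -/
def RemovesString {k : ℕ} (p : Fin (k + 1)) (τ : Equiv.Perm (Fin (k + 1)))
    (σ : Equiv.Perm (Fin k)) : Prop :=
  ∀ j : Fin k, τ (p.succAbove j) = (τ p).succAbove (σ j)

/-- Stability under removing outer strings: a string joining the leftmost upper leg to the leftmost
lower leg, or the rightmost upper leg to the rightmost lower leg. -/
def StableRemovingOuter (G : FilteredSubgroup) : Prop :=
  ∀ (k : ℕ) (τ : Equiv.Perm (Fin (k + 1))) (σ : Equiv.Perm (Fin k)), τ ∈ G.level (k + 1) →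
    ((τ 0 = 0 ∧ RemovesString 0 τ σ) ∨
      (τ (Fin.last k) = Fin.last k ∧ RemovesString (Fin.last k) τ σ)) →
    σ ∈ G.level k

/-- Stability under removing neighbouring strings: two strings starting at neighbouring upper legs
`p`, `p + 1` and ending at neighbouring lower legs, in any order, can be removed together (first
the one at `p + 1`, then the one at `p`). -/
def StableRemovingNeighbours (G : FilteredSubgroup) : Prop :=
  ∀ (k : ℕ) (p : Fin (k + 1)) (τ : Equiv.Perm (Fin (k + 2))) (ρ : Equiv.Perm (Fin (k + 1)))
    (σ : Equiv.Perm (Fin k)), τ ∈ G.level (k + 2) →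
    ((τ p.succ).val = (τ p.castSucc).val + 1 ∨ (τ p.castSucc).val = (τ p.succ).val + 1) →
    RemovesString p.succ τ ρ → RemovesString p ρ σ →
    σ ∈ G.level k

end MonomialSphere

end

/-! Monomial spheres correspond to filtered groups of permutations which are stable under removing
outer and neighbouring strings, and such groups are `{1}`, `S_∞^*` and `S_∞`. -/

namespace MonomialSphere

open Equiv

/-! ### Permutations of `ℕ` extending finite permutations -/

/-! For a closed subspace `S`, the permutations whose relations hold in `C(S)` form a filtered
group. Multiplying a relation by a coordinate and summing over it with `∑ xₜ² = 1` cancels an outer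
letter; giving two neighbouring letters the same index `t` and summing cancels that pair. So this
group is stable under both removals, and the classification of stable groups leaves three
possibilities. The ideal of a monomial sphere is recovered from its group, since `S_∞^*` and `S_∞`
are the stable groups detected by the transpositions `(0 2)` and `(0 1)`, whose relations define the
half-liberated and the real sphere.

For the classification (`FilteredSubgroup.eq_of_stable`), take a nontrivial `f ∈ G` and translate it
until its support meets that of `f` in one point. The commutator is then a `3`-cycle, and removing
neighbouring strings shrinks it to some `(i i+1)` or `(i i+2)`. Outer removal and concatenation
translate this transposition everywhere, so `G` contains `S_∞` or `S_∞^*`, and nothing lies strictly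
between these.

The analytic input is `realSphere_ideal_le`: commutation relations alone must force every element
vanishing on the real sphere into the ideal. This is Gelfand duality for the quotient, using only
its Banach algebra structure and functional calculus upstairs. -/

/-- `f` acts as `σ` on `{0, …, k - 1}` and trivially elsewhere. -/
def Extends (f : Perm ℕ) {k : ℕ} (σ : Perm (Fin k)) : Prop :=
  (∀ i : Fin k, f i = σ i) ∧ ∀ i, k ≤ i → f i = i

theorem Extends.unique {f : Perm ℕ} {k : ℕ} {σ τ : Perm (Fin k)} (hσ : Extends f σ)
    (hτ : Extends f τ) : σ = τ := by
  ext i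
  rw [← hσ.1, ← hτ.1]

theorem exists_extends {k : ℕ} (σ : Perm (Fin k)) : ∃ f, Extends f σ := by
  refine ⟨σ.viaFintypeEmbedding Fin.valEmbedding, fun i => ?_, fun i hi => ?_⟩
  · exact σ.viaFintypeEmbedding_apply_image Fin.valEmbedding i
  · refine σ.viaFintypeEmbedding_apply_notMem_range Fin.valEmbedding ?_
    rintro ⟨j, rfl⟩
    exact absurd j.2 (not_lt.2 hi)

theorem Extends.concat {f g h : Perm ℕ} {k l : ℕ} {σ : Perm (Fin k)} {π : Perm (Fin l)}
    (hσ : Extends f σ) (hπ : Extends g π) (h₁ : ∀ i < k, h i = f i)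
    (h₂ : ∀ i, h (k + i) = k + g i) : Extends h (concat σ π) := by
  refine ⟨fun i => ?_, fun i hi => ?_⟩
  · refine Fin.addCases (fun i => ?_) (fun i => ?_) i
    · rw [concat_castAdd, Fin.val_castAdd, h₁ _ i.2, hσ.1, Fin.val_castAdd]
    · rw [concat_natAdd, Fin.val_natAdd, h₂, hπ.1, Fin.val_natAdd]
  · obtain ⟨j, rfl⟩ := Nat.exists_eq_add_of_le (show k ≤ i by omega)
    rw [h₂, hπ.2 j (by omega)]

theorem extends_one (k : ℕ) : Extends 1 (1 : Perm (Fin k)) :=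
  ⟨fun _ => rfl, fun _ _ => rfl⟩

theorem Extends.mul {f g : Perm ℕ} {k : ℕ} {σ τ : Perm (Fin k)} (hσ : Extends f σ)
    (hτ : Extends g τ) : Extends (f * g) (σ * τ) :=
  ⟨fun i => by rw [Perm.mul_apply, hτ.1, hσ.1, Perm.mul_apply],
    fun i hi => by rw [Perm.mul_apply, hτ.2 i hi, hσ.2 i hi]⟩

theorem Extends.inv {f : Perm ℕ} {k : ℕ} {σ : Perm (Fin k)} (hσ : Extends f σ) :
    Extends f⁻¹ σ⁻¹ :=
  ⟨fun i => by rw [Perm.inv_eq_iff_eq, hσ.1]; simp,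
    fun i hi => by rw [Perm.inv_eq_iff_eq, hσ.2 i hi]⟩

/-- Every permutation of `ℕ` which is trivial from `k` on extends a permutation of `Fin k`. -/
theorem exists_extends_of_fixed {f : Perm ℕ} {k : ℕ} (hf : ∀ i, k ≤ i → f i = i) :
    ∃ σ : Perm (Fin k), Extends f σ := by
  have hlt : ∀ i : Fin k, f i < k := fun i => by
    by_contra! h
    have := f.injective (hf _ h)
    omega
  have hinj : Function.Injective fun i : Fin k => (⟨f i, hlt i⟩ : Fin k) := fun i j hij =>
    Fin.ext (f.injective (congrArg Fin.val hij))
  exact ⟨Equiv.ofBijective _ (Finite.injective_iff_bijective.1 hinj), fun i => rfl, hf⟩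

/-- The string at `p` can be removed from any diagram. -/
theorem exists_removesString {k : ℕ} (p : Fin (k + 1)) (τ : Perm (Fin (k + 1))) :
    ∃ σ, RemovesString p τ σ := by
  have h : ∀ j : Fin k, ∃ i, (τ p).succAbove i = τ (p.succAbove j) := fun j =>
    Fin.exists_succAbove_eq fun h => Fin.succAbove_ne p j (τ.injective h)
  choose ρ hρ using h
  have hinj : Function.Injective ρ := fun i j hij => by
    apply Fin.succAbove_right_injective (p := p)
    apply τ.injective
    rw [← hρ, ← hρ, hij]
  exact ⟨Equiv.ofBijective ρ (Finite.injective_iff_bijective.1 hinj), fun j => (hρ j).symm⟩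

/-- The permutation of `ℕ` fixing `0` and acting as `f` on the other points. -/
def shift (f : Perm ℕ) : Perm ℕ where
  toFun n := n.casesOn 0 fun n => f n + 1
  invFun n := n.casesOn 0 fun n => f⁻¹ n + 1
  left_inv n := by cases n <;> simp
  right_inv n := by cases n <;> simp

@[simp] theorem shift_zero (f : Perm ℕ) : shift f 0 = 0 := rfl

@[simp] theorem shift_succ (f : Perm ℕ) (n : ℕ) : shift f (n + 1) = f n + 1 := rfl

theorem shift_swap (i j : ℕ) : shift (swap i j) = swap (i + 1) (j + 1) := by
  ext n
  cases n with
  | zero => rw [shift_zero, swap_apply_of_ne_of_ne] <;> omega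
  | succ n =>
    rw [shift_succ]
    simp only [swap_apply_def]
    split_ifs <;> omega

theorem shift_iterate_apply (f : Perm ℕ) (m : ℕ) :
    (∀ i < m, shift^[m] f i = i) ∧ ∀ i, shift^[m] f (m + i) = m + f i := by
  induction m with
  | zero => simp
  | succ m ih =>
    rw [Function.iterate_succ_apply']
    refine ⟨fun i hi => ?_, fun i => ?_⟩
    · cases i with
      | zero => rfl
      | succ i => rw [shift_succ, ih.1 i (by omega)]
    · rw [show m + 1 + i = m + i + 1 by omega, shift_succ, ih.2]
      omega

/-! ### Filtered subgroups as groups of finitely supported permutations of `ℕ` -/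

namespace FilteredSubgroup

variable (G : FilteredSubgroup)

theorem exists_extends_of_le {f : Perm ℕ} {k m : ℕ} {σ : Perm (Fin k)} (hσ : Extends f σ)
    (hkm : k ≤ m) : ∃ τ : Perm (Fin m), Extends f τ ∧ (τ ∈ G.level m ↔ σ ∈ G.level k) := by
  induction m, hkm using Nat.le_induction with
  | base => exact ⟨σ, hσ, Iff.rfl⟩
  | succ m hm ih =>
    obtain ⟨τ, hτ, h⟩ := ih
    refine ⟨concat τ 1, ?_, (G.mem_succ_iff τ).trans h⟩
    exact hτ.concat (extends_one 1) (fun _ _ => rfl) fun i => hτ.2 _ (by omega)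

/-- A filtered subgroup, as a group of permutations of `ℕ`. -/
def union : Subgroup (Perm ℕ) where
  carrier := {f | ∃ (k : ℕ) (σ : Perm (Fin k)), σ ∈ G.level k ∧ Extends f σ}
  one_mem' := ⟨0, 1, one_mem _, extends_one 0⟩
  mul_mem' := by
    rintro f g ⟨k, σ, hσ, hf⟩ ⟨l, τ, hτ, hg⟩
    obtain ⟨σ', hf', h⟩ := G.exists_extends_of_le hf (le_max_left k l)
    obtain ⟨τ', hg', h'⟩ := G.exists_extends_of_le hg (le_max_right k l)
    exact ⟨_, _, mul_mem (h.2 hσ) (h'.2 hτ), hf'.mul hg'⟩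
  inv_mem' := by
    rintro f ⟨k, σ, hσ, hf⟩
    exact ⟨k, σ⁻¹, inv_mem hσ, hf.inv⟩

variable {G}

theorem exists_fixed_of_mem_union {f : Perm ℕ} (hf : f ∈ G.union) : ∃ k, ∀ i, k ≤ i → f i = i :=
  let ⟨k, _, _, h⟩ := hf
  ⟨k, h.2⟩

/-- Adding fixed points at the right does not affect membership, by the equivalence `mem_succ_iff`;
hence the levels can be read off from the union. -/
theorem mem_level_iff {f : Perm ℕ} {k : ℕ} {σ : Perm (Fin k)} (hf : Extends f σ) :
    σ ∈ G.level k ↔ f ∈ G.union := by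
  refine ⟨fun h => ⟨k, σ, h, hf⟩, ?_⟩
  rintro ⟨l, τ, hτ, hg⟩
  obtain ⟨σ', hf', h⟩ := G.exists_extends_of_le hf (le_max_left k l)
  obtain ⟨τ', hg', h'⟩ := G.exists_extends_of_le hg (le_max_right k l)
  rw [hf'.unique hg'] at h
  exact h.1 (h'.2 hτ)

theorem ext_union {G H : FilteredSubgroup} (h : G.union = H.union) : G = H := by
  ext k σ
  obtain ⟨f, hf⟩ := exists_extends σ
  rw [mem_level_iff hf, mem_level_iff hf, h]

theorem shift_mem {f : Perm ℕ} (hf : f ∈ G.union) : shift f ∈ G.union := by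
  obtain ⟨k, σ, hσ, hf⟩ := hf
  refine ⟨1 + k, concat 1 σ, G.concat_mem (one_mem _) hσ, ?_⟩
  refine (extends_one 1).concat hf (fun i hi => ?_) fun i => ?_
  · rw [Nat.lt_one_iff.1 hi]; rfl
  · rw [add_comm 1 i, shift_succ, add_comm]

theorem shift_iterate_mem {f : Perm ℕ} (hf : f ∈ G.union) (m : ℕ) : shift^[m] f ∈ G.union := by
  induction m with
  | zero => exact hf
  | succ m ih =>
    rw [Function.iterate_succ_apply']
    exact shift_mem ih

/-- The string at `0` of `shift f` is a left outer string, and deleting it undoes the shift. -/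
theorem mem_of_shift_mem (hG : StableRemovingOuter G) {f : Perm ℕ} (hf : shift f ∈ G.union) :
    f ∈ G.union := by
  obtain ⟨k, σ, hσ, h⟩ := hf
  obtain ⟨τ, hτ, hk⟩ := G.exists_extends_of_le h (Nat.le_succ k)
  have hfix : ∀ i, k ≤ i → f i = i := fun i hi => by
    have := h.2 (i + 1) (by omega)
    rw [shift_succ] at this
    omega
  obtain ⟨ρ, hρ⟩ := exists_extends_of_fixed hfix
  refine ⟨k, ρ, hG k τ ρ (hk.2 hσ) (Or.inl ?_), hρ⟩
  have h0 : τ 0 = 0 := by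
    apply Fin.ext
    rw [← hτ.1, Fin.val_zero, shift_zero]
  refine ⟨h0, fun j => Fin.ext ?_⟩
  rw [h0, ← hτ.1, Fin.zero_succAbove, Fin.zero_succAbove, Fin.val_succ, Fin.val_succ, shift_succ,
    hρ.1]

theorem swap_mem_of_swap_add_mem (hG : StableRemovingOuter G) {i j m : ℕ}
    (h : swap (i + m) (j + m) ∈ G.union) : swap i j ∈ G.union := by
  induction m with
  | zero => exact h
  | succ m ih => exact ih (mem_of_shift_mem hG (by rw [shift_swap]; exact h))

theorem swap_add_mem {i j : ℕ} (h : swap i j ∈ G.union) (m : ℕ) :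
    swap (i + m) (j + m) ∈ G.union := by
  induction m with
  | zero => exact h
  | succ m ih =>
    have := shift_mem ih
    rwa [shift_swap] at this

/-- Removal of neighbouring strings, for permutations of `ℕ`. -/
theorem mem_of_removal (hG : StableRemovingNeighbours G) {f g : Perm ℕ} (hf : f ∈ G.union)
    (p q : ℕ) (hpq : f p = q ∧ f (p + 1) = q + 1 ∨ f p = q + 1 ∧ f (p + 1) = q)
    (hg : ∀ j, f (if j < p then j else j + 2) = if g j < q then g j else g j + 2) :
    g ∈ G.union := by
  obtain ⟨k, σ, hσ, h⟩ := hf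
  -- This size makes `p + 1` and `q + 1` legs of the diagram, and `g` is trivial from `k + p + q`
  -- on.
  obtain ⟨τ, hτ, hk⟩ := G.exists_extends_of_le h (show k ≤ k + p + q + 2 by omega)
  have hfix : ∀ i, k + p + q ≤ i → g i = i := fun i hi => by
    have := hg i
    rw [if_neg (by omega), h.2 _ (by omega)] at this
    split_ifs at this <;> omega
  obtain ⟨π, hπ⟩ := exists_extends_of_fixed hfix
  let p' : Fin (k + p + q + 1) := ⟨p, by omega⟩
  have hp : f p = τ p'.castSucc := hτ.1 p'.castSucc
  have hp1 : f (p + 1) = τ p'.succ := hτ.1 p'.succ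
  obtain ⟨ρ, hρ⟩ := exists_removesString p'.succ τ
  refine ⟨k + p + q, π, hG _ p' τ ρ π (hk.2 hσ) (by omega) hρ ?_, hπ⟩
  have hρp := congrArg Fin.val (hρ p')
  rw [show p'.succ.succAbove p' = p'.castSucc by simp] at hρp
  intro j
  have h1 := congrArg Fin.val (hρ (p'.succAbove j))
  have h2 := hg j
  rw [hπ.1] at h2
  have h3 : ((p'.succ.succAbove (p'.succAbove j) : Fin _) : ℕ) =
      if (j : ℕ) < p then (j : ℕ) else j + 2 := by
    simp only [Fin.succAbove, Fin.lt_def, p']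
    split_ifs <;> simp_all; omega
  rw [← hτ.1, h3, h2] at h1
  apply Fin.ext
  simp only [Fin.succAbove, Fin.lt_def] at h1 hρp ⊢
  clear h2 h3
  split_ifs at h1 hρp ⊢ <;> simp at * <;> omega

end FilteredSubgroup
-- From a nontrivial element to a short transposition
-- The cycle is `a ↦ c ↦ b ↦ a`; the disjunctive form lets `omega` check all the removals.
theorem threeCycle_apply {a b c : ℕ} (hab : a < b) (hbc : b < c) (x : ℕ) :
    (x = a ∧ (swap a c * swap b c) x = c) ∨ (x = b ∧ (swap a c * swap b c) x = a) ∨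
      (x = c ∧ (swap a c * swap b c) x = b) ∨
        (x ≠ a ∧ x ≠ b ∧ x ≠ c ∧ (swap a c * swap b c) x = x) := by
  rcases eq_or_ne x a with rfl | ha
  · left
    rw [Perm.mul_apply, swap_apply_of_ne_of_ne hab.ne (hab.trans hbc).ne, swap_apply_left]
    exact ⟨rfl, rfl⟩
  rcases eq_or_ne x b with rfl | hb
  · simp
  rcases eq_or_ne x c with rfl | hc
  · rw [Perm.mul_apply, swap_apply_right, swap_apply_of_ne_of_ne hab.ne' hbc.ne]
    simp
  · rw [Perm.mul_apply, swap_apply_of_ne_of_ne hb hc, swap_apply_of_ne_of_ne ha hc]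
    simp [*]

theorem swap_apply_cases {a b : ℕ} (x : ℕ) :
    (x = a ∧ swap a b x = b) ∨ (x = b ∧ swap a b x = a) ∨
      (x ≠ a ∧ x ≠ b ∧ swap a b x = x) := by
  rw [swap_apply_def]
  split_ifs <;> simp_all

namespace FilteredSubgroup

variable {G : FilteredSubgroup}

/-- The criterion `mem_of_removal` with the conditional expressions split. -/
theorem mem_of_removal_of_forall (hG : StableRemovingNeighbours G) {f g : Perm ℕ}
    (hf : f ∈ G.union) (p q : ℕ)
    (hpq : f p = q ∧ f (p + 1) = q + 1 ∨ f p = q + 1 ∧ f (p + 1) = q)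
    (hlt : ∀ j < p, g j < q ∧ f j = g j ∨ q ≤ g j ∧ f j = g j + 2)
    (hle : ∀ j, p ≤ j → g j < q ∧ f (j + 2) = g j ∨ q ≤ g j ∧ f (j + 2) = g j + 2) :
    g ∈ G.union := by
  refine mem_of_removal hG hf p q hpq fun j => ?_
  by_cases h : j < p
  · rw [if_pos h]
    rcases hlt j h with ⟨h1, h2⟩ | ⟨h1, h2⟩
    · rw [if_pos h1, h2]
    · rw [if_neg (by omega), h2]
  · rw [if_neg h]
    rcases hle j (by omega) with ⟨h1, h2⟩ | ⟨h1, h2⟩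
    · rw [if_pos h1, h2]
    · rw [if_neg (by omega), h2]

/-- A `3`-cycle can be reduced, by removing strings, to an adjacent transposition or to a
half-liberating one. -/
theorem swap_mem_of_threeCycle_mem (hG : StableRemovingNeighbours G)
    {a b c : ℕ} (hab : a < b) (hbc : b < c) (h : swap a c * swap b c ∈ G.union) :
    ∃ i, swap i (i + 1) ∈ G.union ∨ swap i (i + 2) ∈ G.union := by
  induction hn : c - a using Nat.strong_induction_on generalizing b c with
  | _ n ih =>
  have key := threeCycle_apply hab hbc
  -- The fixed strings at `a + 1` and `a + 2` can be deleted, which lowers `b` and `c` by two.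
  by_cases h1 : a + 3 ≤ b
  · have hab' : a < b - 2 := by omega
    have hbc' : b - 2 < c - 2 := by omega
    have key' := threeCycle_apply hab' hbc'
    refine ih (c - 2 - a) (by omega) hab' hbc' ?_ rfl
    refine mem_of_removal_of_forall hG h (a + 1) (a + 1) ?_ (fun j hj => ?_) fun j hj => ?_
    · have := key (a + 1); have := key (a + 1 + 1); omega
    · have := key j; have := key' j; omega
    · have := key (j + 2); have := key' j; omega
  -- Likewise with the fixed strings at `b + 1` and `b + 2`, lowering only `c`.
  by_cases h2 : b + 3 ≤ c
  · have hbc' : b < c - 2 := by omega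
    have key' := threeCycle_apply hab hbc'
    refine ih (c - 2 - a) (by omega) hab hbc' ?_ rfl
    refine mem_of_removal_of_forall hG h (b + 1) (b + 1) ?_ (fun j hj => ?_) fun j hj => ?_
    · have := key (b + 1); have := key (b + 1 + 1); omega
    · have := key j; have := key' j; omega
    · have := key (j + 2); have := key' j; omega
  have key₁ := swap_apply_cases (a := a) (b := a + 1)
  have key₂ := swap_apply_cases (a := a) (b := a + 2)
  refine ⟨a, ?_⟩
  -- Both gaps are now `1` or `2`.
  obtain ⟨rfl, rfl⟩ | ⟨rfl, rfl⟩ | ⟨rfl, rfl⟩ | ⟨rfl, rfl⟩ :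
      (b = a + 1 ∧ c = a + 2) ∨ (b = a + 1 ∧ c = a + 3) ∨ (b = a + 2 ∧ c = a + 3) ∨
        (b = a + 2 ∧ c = a + 4) := by omega
  -- On three consecutive points, deleting the neighbouring strings of the cycle leaves only the
  -- identity. Instead, `shift f * f` is `(a a+1)(a+2 a+3)`, and the strings of its second factor
  -- are deleted.
  · left
    set f := swap a (a + 2) * swap (a + 1) (a + 2) with hf
    have hs : shift f = swap (a + 1) (a + 3) * swap (a + 2) (a + 3) := by
      ext i
      cases i with
      | zero =>
        have := threeCycle_apply (show a + 1 < a + 2 by omega) (show a + 2 < a + 3 by omega) 0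
        rw [shift_zero]; omega
      | succ i =>
        have := threeCycle_apply (show a + 1 < a + 2 by omega) (show a + 2 < a + 3 by omega)
          (i + 1)
        have := key i
        rw [shift_succ]; omega
    have key' := threeCycle_apply (show a + 1 < a + 2 by omega) (show a + 2 < a + 3 by omega)
    rw [← hs] at key'
    refine mem_of_removal_of_forall hG (mul_mem (shift_mem h) h) (a + 2) (a + 2) ?_
      (fun j hj => ?_) fun j hj => ?_ <;> simp only [Perm.mul_apply (shift f)]
    · have := key (a + 2); have := key (a + 2 + 1)
      have := key' (f (a + 2)); have := key' (f (a + 2 + 1)); omega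
    · have := key j; have := key' (f j); have := key₁ j; omega
    · have := key (j + 2); have := key' (f (j + 2)); have := key₁ j; omega
  · left
    refine mem_of_removal_of_forall hG h (a + 2) (a + 1) ?_ (fun j hj => ?_) fun j hj => ?_
    · have := key (a + 2); have := key (a + 2 + 1); omega
    · have := key j; have := key₁ j; omega
    · have := key (j + 2); have := key₁ j; omega
  · left
    refine mem_of_removal_of_forall hG h (a + 1) a ?_ (fun j hj => ?_) fun j hj => ?_
    · have := key (a + 1); have := key (a + 1 + 1); omega
    · have := key j; have := key₁ j; omega
    · have := key (j + 2); have := key₁ j; omega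
  · right
    refine mem_of_removal_of_forall hG h (a + 1) a ?_ (fun j hj => ?_) fun j hj => ?_
    · have := key (a + 1); have := key (a + 1 + 1); omega
    · have := key j; have := key₂ j; omega
    · have := key (j + 2); have := key₂ j; omega

/-- If `f` moves only points of `[a, b]`, and moves `b`, then the commutator of `f` with its
translate by `b - a` is a `3`-cycle. -/
theorem exists_threeCycle_mem {f : Perm ℕ} (hf : f ∈ G.union) (hne : f ≠ 1) :
    ∃ a b c, a < b ∧ b < c ∧ swap a c * swap b c ∈ G.union := by
  classical
  have hex : ∃ i, f i ≠ i := by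
    by_contra! h
    exact hne (Perm.ext h)
  obtain ⟨k, hk⟩ := exists_fixed_of_mem_union hf
  set a := Nat.find hex with ha
  have ha₁ : f a ≠ a := Nat.find_spec hex
  have ha₂ : ∀ i < a, f i = i := fun i hi => not_not.1 (Nat.find_min hex hi)
  set b := Nat.findGreatest (fun i => f i ≠ i) k with hb
  have hak : a ≤ k := by
    by_contra! h
    exact ha₁ (hk a h.le)
  have hb₁ : f b ≠ b := Nat.findGreatest_spec (P := fun i => f i ≠ i) hak ha₁
  have hb₂ : ∀ i, b < i → f i = i := fun i hi => by
    by_cases hik : i ≤ k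
    · exact not_not.1 (Nat.findGreatest_is_greatest hi hik)
    · exact hk i (by omega)
  have hab : a ≤ b := Nat.le_findGreatest hak ha₁
  have hfb : f b < b := by
    by_contra! h
    exact hb₁ (f.injective (hb₂ (f b) (by omega)))
  have hfa : a < f a := by
    by_contra! h
    exact ha₁ (f.injective (ha₂ (f a) (by omega)))
  -- The first point moved by `g` is `b`, the last point moved by `f`.
  set g := shift^[b - a] f with hg
  have hgm : g ∈ G.union := shift_iterate_mem hf _
  obtain ⟨hg₁, hg₂⟩ := shift_iterate_apply f (b - a)
  rw [← hg] at hg₁ hg₂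
  have hg₃ : ∀ i < b, g i = i := fun i hi => by
    by_cases h : i < b - a
    · exact hg₁ i h
    · have := hg₂ (i - (b - a))
      rw [show b - a + (i - (b - a)) = i by omega, ha₂ _ (by omega)] at this
      omega
  set c := b - a + f a with hc
  have hgb : g b = c := by
    have := hg₂ a
    rwa [show b - a + a = b by omega] at this
  have hbc : b < c := by omega
  refine ⟨f b, b, c, hfb, hbc, ?_⟩
  -- Correcting `g` by `(b c)` makes it fix `b` too, hence commute with `f`. So conjugating `f⁻¹` by
  -- `g` is the same as conjugating it by `(b c)`.
  have hdisj : Perm.Disjoint (swap b c * g) f := fun x => by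
    rcases lt_trichotomy x b with h | rfl | h
    · left
      rw [Perm.mul_apply, hg₃ x h, swap_apply_of_ne_of_ne h.ne (h.trans hbc).ne]
    · left
      rw [Perm.mul_apply, hgb, swap_apply_right]
    · exact Or.inr (hb₂ x h)
  have hcomm : (swap b c * g) * f⁻¹ * (swap b c * g)⁻¹ = f⁻¹ := by
    rw [mul_inv_eq_iff_eq_mul]
    exact hdisj.commute.inv_right.eq
  have hconj : g * f⁻¹ * g⁻¹ = swap b c * f⁻¹ * swap b c := by
    have : g * f⁻¹ * g⁻¹ =
        swap b c * ((swap b c * g) * f⁻¹ * (swap b c * g)⁻¹) * swap b c := by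
      simp only [mul_inv_rev, swap_inv, mul_assoc, swap_mul_self, mul_one, swap_mul_self_mul]
    rw [this, hcomm]
  have hfc : f c = c := hb₂ c hbc
  -- As `f c = c`, conjugating `(b c)` by `f` gives `(f b, c)`.
  have : swap (f b) c * swap b c = f * (g * f⁻¹ * g⁻¹) := by
    nth_rewrite 1 [← hfc]
    rw [hconj, swap_apply_apply]
    simp only [mul_assoc]
  rw [this]
  exact mul_mem hf (mul_mem (mul_mem hgm (inv_mem hf)) (inv_mem hgm))

/-! ### Generation by transpositions, and the classification -/

/-- A group containing the transpositions of related points contains all finitely supported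
permutations whose graph is in the relation. -/
theorem mem_of_forall_swap_mem {r : ℕ → ℕ → Prop} (hr : Equivalence r) {H : Subgroup (Perm ℕ)}
    (hH : ∀ i j, r i j → swap i j ∈ H) {f : Perm ℕ} {k : ℕ} (hk : ∀ i, k ≤ i → f i = i)
    (hf : ∀ i, r (f i) i) : f ∈ H := by
  induction k generalizing f with
  | zero =>
    have : f = 1 := Perm.ext fun i => hk i (Nat.zero_le i)
    rw [this]
    exact one_mem H
  | succ k ih =>
    have hk' : f k ≤ k := by
      by_contra! h
      have := f.injective (hk _ h)
      omega
    -- Composing with this transposition makes `k` a fixed point and keeps the graph in `r`.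
    have hs : swap (f k) k ∈ H := hH _ _ (hf k)
    have : swap (f k) k * f ∈ H := by
      refine ih (fun i hi => ?_) fun i => ?_
      · rcases hi.eq_or_lt with rfl | hi
        · rw [Perm.mul_apply, swap_apply_left]
        · rw [Perm.mul_apply, hk i hi, swap_apply_of_ne_of_ne (by omega) (by omega)]
      · rw [Perm.mul_apply]
        rcases swap_apply_cases (a := f k) (b := k) (f i) with ⟨h1, h2⟩ | ⟨h1, h2⟩ | ⟨_, _, h2⟩
        · rw [h2, f.injective h1]
          exact hr.refl k
        · rw [h2]
          exact hr.trans (hf k) (h1 ▸ hf i)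
        · rw [h2]
          exact hf i
    exact (mul_mem_cancel_left hs).1 this

/-- If all `swap i (i + d)` belong to a group, so do the transpositions of all points congruent
modulo `d`. -/
theorem swap_mem_of_mod_eq {H : Subgroup (Perm ℕ)} {d : ℕ} (h : ∀ i, swap i (i + d) ∈ H)
    {i j : ℕ} (hij : i % d = j % d) : swap i j ∈ H := by
  have key : ∀ i n, swap i (i + d * n) ∈ H := fun i n => by
    induction n with
    | zero =>
      rw [mul_zero, add_zero, swap_self]
      exact one_mem H
    | succ n ih => exact SubmonoidClass.swap_mem_trans H ih (by
        rw [mul_add, mul_one, ← add_assoc]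
        exact h _)
  wlog hle : i ≤ j generalizing i j
  · rw [swap_comm]
    exact this hij.symm (by omega)
  obtain ⟨n, hn⟩ := (Nat.modEq_iff_dvd' hle).1 hij
  rw [show j = i + d * n by omega]
  exact key i n

theorem mem_union_trivialGroup {f : Perm ℕ} : f ∈ trivialGroup.union ↔ f = 1 := by
  refine ⟨?_, fun h => h ▸ one_mem _⟩
  rintro ⟨k, σ, hσ, hf⟩
  obtain rfl : σ = 1 := hσ
  ext i
  by_cases hi : i < k
  · exact hf.1 ⟨i, hi⟩
  · exact hf.2 i (by omega)

theorem mem_union_parityGroup {f : Perm ℕ} :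
    f ∈ parityGroup.union ↔ (∃ k, ∀ i, k ≤ i → f i = i) ∧ ∀ i, f i % 2 = i % 2 := by
  constructor
  · rintro ⟨k, σ, hσ, hf⟩
    refine ⟨⟨k, hf.2⟩, fun i => ?_⟩
    by_cases hi : i < k
    · exact (congrArg (· % 2) (hf.1 ⟨i, hi⟩)).trans (hσ ⟨i, hi⟩)
    · rw [hf.2 i (by omega)]
  · rintro ⟨⟨k, hk⟩, h⟩
    obtain ⟨σ, hσ⟩ := exists_extends_of_fixed hk
    refine ⟨k, σ, fun i => ?_, hσ⟩
    rw [← hσ.1]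
    exact h i

theorem mem_union_fullGroup {f : Perm ℕ} :
    f ∈ fullGroup.union ↔ ∃ k, ∀ i, k ≤ i → f i = i := by
  refine ⟨exists_fixed_of_mem_union, ?_⟩
  rintro ⟨k, hk⟩
  obtain ⟨σ, hσ⟩ := exists_extends_of_fixed hk
  exact ⟨k, σ, Subgroup.mem_top _, hσ⟩

theorem eq_fullGroup_of_swap_mem (h : ∀ i, swap i (i + 1) ∈ G.union) : G = fullGroup := by
  refine ext_union (le_antisymm (fun f hf => ?_) fun f hf => ?_)
  · exact mem_union_fullGroup.2 (exists_fixed_of_mem_union hf)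
  · obtain ⟨k, hk⟩ := mem_union_fullGroup.1 hf
    exact mem_of_forall_swap_mem (r := fun i j => i % 1 = j % 1)
      ⟨fun _ => rfl, Eq.symm, Eq.trans⟩ (fun i j => swap_mem_of_mod_eq h) hk
      fun i => by simp only [Nat.mod_one]

theorem parityGroup_union_le (h : ∀ i, swap i (i + 2) ∈ G.union) :
    parityGroup.union ≤ G.union := fun f hf => by
  obtain ⟨⟨k, hk⟩, hf⟩ := mem_union_parityGroup.1 hf
  exact mem_of_forall_swap_mem (r := fun i j => i % 2 = j % 2)
    ⟨fun _ => rfl, Eq.symm, Eq.trans⟩ (fun i j => swap_mem_of_mod_eq h) hk hf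

/-- There is nothing between `S_∞^*` and `S_∞`. -/
theorem eq_fullGroup_of_swap_add_two_mem (h : ∀ i, swap i (i + 2) ∈ G.union)
    {f : Perm ℕ} (hf : f ∈ G.union) {i : ℕ} (hi : f i % 2 ≠ i % 2) : G = fullGroup := by
  have hpar : ∀ {i j : ℕ}, i % 2 = j % 2 → swap i j ∈ G.union := swap_mem_of_mod_eq h
  obtain ⟨k, hk⟩ := exists_fixed_of_mem_union hf
  -- The point `i + 2 * k` has the parity of `i` and is fixed by `f`. Conjugating `(i, i + 2k)` by
  -- `f` gives a transposition of points of opposite parity.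
  have h1 : swap (f i) (i + 2 * k) ∈ G.union := by
    have : swap (f i) (f (i + 2 * k)) ∈ G.union := by
      rw [swap_apply_apply]
      exact mul_mem (mul_mem hf (hpar (by omega))) (inv_mem hf)
    rwa [hk (i + 2 * k) (by omega)] at this
  refine eq_fullGroup_of_swap_mem fun j => ?_
  by_cases hj : f i % 2 = j % 2
  · exact SubmonoidClass.swap_mem_trans _ (hpar hj.symm)
      (SubmonoidClass.swap_mem_trans _ h1 (hpar (by omega)))
  · exact SubmonoidClass.swap_mem_trans _ (hpar (i := j) (j := i + 2 * k) (by omega))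
      (SubmonoidClass.swap_mem_trans _ (swap_comm (f i) _ ▸ h1)
        (hpar (by omega)))

theorem eq_of_stable (hG : StableRemovingOuter G) (hG' : StableRemovingNeighbours G) :
    G = trivialGroup ∨ G = parityGroup ∨ G = fullGroup := by
  by_cases htriv : ∀ f ∈ G.union, f = 1
  · left
    refine ext_union (le_antisymm (fun f hf => mem_union_trivialGroup.2 (htriv f hf)) ?_)
    intro f hf
    rw [mem_union_trivialGroup.1 hf]
    exact one_mem _
  right
  push Not at htriv
  obtain ⟨f, hf, hne⟩ := htriv
  obtain ⟨a, b, c, hab, hbc, h⟩ := exists_threeCycle_mem hf hne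
  -- Outer removal brings the transposition down to `(0 d)`; concatenation with identity strings
  -- then moves it up to `j`.
  have hall : ∀ d i, swap i (i + d) ∈ G.union → ∀ j, swap j (j + d) ∈ G.union := by
    intro d i hi j
    have h0 : swap 0 d ∈ G.union :=
      swap_mem_of_swap_add_mem hG (m := i) (by rwa [zero_add, add_comm d])
    have := swap_add_mem h0 j
    rwa [zero_add, add_comm d] at this
  obtain ⟨i, hi | hi⟩ := swap_mem_of_threeCycle_mem hG' hab hbc h
  · exact Or.inr (eq_fullGroup_of_swap_mem (hall 1 i hi))
  · have h2 := hall 2 i hi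
    by_cases hpar : ∀ f ∈ G.union, ∀ i, f i % 2 = i % 2
    · refine Or.inl (ext_union (le_antisymm (fun f hf => ?_) (parityGroup_union_le h2)))
      exact mem_union_parityGroup.2 ⟨exists_fixed_of_mem_union hf, hpar f hf⟩
    · push Not at hpar
      obtain ⟨f, hf, i, hi⟩ := hpar
      exact Or.inr (eq_fullGroup_of_swap_add_two_mem h2 hf hi)

end FilteredSubgroup

/-! ### Stability of the three groups -/

theorem RemovesString.eq_one {k : ℕ} {p : Fin (k + 1)} {σ : Perm (Fin k)}
    (h : RemovesString p 1 σ) : σ = 1 := by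
  ext j
  exact congrArg Fin.val (Fin.succAbove_right_injective (h j)).symm

theorem stableRemovingOuter_trivialGroup : StableRemovingOuter trivialGroup := by
  intro k τ σ hτ h
  obtain rfl : τ = 1 := hτ
  rcases h with ⟨_, h⟩ | ⟨_, h⟩ <;> exact h.eq_one

theorem stableRemovingNeighbours_trivialGroup : StableRemovingNeighbours trivialGroup := by
  intro k p τ ρ σ hτ _ h h'
  obtain rfl : τ = 1 := hτ
  rw [h.eq_one] at h'
  exact h'.eq_one

/-- Left removal lowers both ends of every string by one, and right removal moves no end. -/
theorem stableRemovingOuter_parityGroup : StableRemovingOuter parityGroup := by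
  rintro k τ σ hτ (⟨h0, h⟩ | ⟨h0, h⟩) j
  · have h1 := congrArg Fin.val (h j)
    have h2 := hτ (Fin.succAbove 0 j)
    rw [h0] at h1
    simp only [Fin.zero_succAbove, Fin.val_succ] at h1 h2
    omega
  · have h1 := congrArg Fin.val (h j)
    have h2 := hτ ((Fin.last k).succAbove j)
    rw [h0] at h1
    simp only [Fin.succAbove_last, Fin.val_castSucc] at h1 h2
    omega

theorem val_succAbove_cases {k : ℕ} (p : Fin (k + 1)) (j : Fin k) :
    (j : ℕ) < p ∧ (p.succAbove j : ℕ) = j ∨ (p : ℕ) ≤ j ∧ (p.succAbove j : ℕ) = j + 1 := by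
  rcases lt_or_ge (j : ℕ) p with h | h
  · exact Or.inl ⟨h, by rw [Fin.succAbove_of_castSucc_lt _ _ h, Fin.val_castSucc]⟩
  · exact Or.inr ⟨h, by rw [Fin.succAbove_of_le_castSucc _ _ h, Fin.val_succ]⟩

/-- The deleted legs are adjacent both above and below, so every remaining end moves by `0` or `2`.
-/
theorem stableRemovingNeighbours_parityGroup : StableRemovingNeighbours parityGroup := by
  intro k p τ ρ σ hτ hn hρ hσ j
  have h1 := congrArg Fin.val (hρ p)
  have h2 := congrArg Fin.val (hρ (p.succAbove j))
  rw [Fin.succAbove_succ_self] at h1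
  rw [hσ j] at h2
  have h3 := hτ (p.succ.succAbove (p.succAbove j))
  have := val_succAbove_cases p j
  have := val_succAbove_cases p.succ (p.succAbove j)
  have := val_succAbove_cases (τ p.succ) (ρ p)
  have := val_succAbove_cases (ρ p) (σ j)
  have := val_succAbove_cases (τ p.succ) ((ρ p).succAbove (σ j))
  have := Fin.val_succ p
  omega

/-- The filtered subgroups which are stable under removing outer and neighbouring strings. -/
theorem stable_iff (G : FilteredSubgroup) :
    (StableRemovingOuter G ∧ StableRemovingNeighbours G) ↔
      G = trivialGroup ∨ G = parityGroup ∨ G = fullGroup := by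
  refine ⟨fun h => FilteredSubgroup.eq_of_stable h.1 h.2, ?_⟩
  rintro (rfl | rfl | rfl)
  · exact ⟨stableRemovingOuter_trivialGroup, stableRemovingNeighbours_trivialGroup⟩
  · exact ⟨stableRemovingOuter_parityGroup, stableRemovingNeighbours_parityGroup⟩
  · exact ⟨fun _ _ _ _ _ => Subgroup.mem_top _, fun _ _ _ _ _ _ _ _ _ => Subgroup.mem_top _⟩

/-! ### Words in the coordinates and the group of their relations -/

section Word

variable {R : Type*} [Ring R] {N : ℕ} (y : Fin N → R)

/-- The product of the `y i₁, …, y iₖ`. -/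
def word {k : ℕ} (i : Fin k → Fin N) : R :=
  (List.ofFn fun j => y (i j)).prod

theorem word_cons {k : ℕ} (t : Fin N) (i : Fin k → Fin N) :
    word y (Fin.cons t i : Fin (k + 1) → Fin N) = y t * word y i := by
  simp [word, List.ofFn_succ]

theorem word_append {k l : ℕ} (i : Fin (k + l) → Fin N) :
    word y i = word y (fun j => i (Fin.castAdd l j)) * word y (fun j => i (Fin.natAdd k j)) := by
  simp only [word, List.ofFn_add, List.prod_append]
  rfl

theorem word_one (i : Fin 1 → Fin N) : word y i = y (i 0) := by
  simp [word]

variable {y}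

/-- The two inserted letters are adjacent, so the sum over `t` replaces `y t ^ 2` by `1`. -/
theorem sum_word_insertNth (hy : ∑ t, y t ^ 2 = 1) {k : ℕ} (p : Fin (k + 1))
    (i : Fin k → Fin N) :
    ∑ t, word y (Fin.insertNth p.succ t (Fin.insertNth p t i : Fin (k + 1) → Fin N) :
      Fin (k + 2) → Fin N) = word y i := by
  induction k with
  | zero =>
    obtain rfl : p = 0 := Subsingleton.elim (α := Fin 1) p 0
    simp_rw [Fin.insertNth_zero', Fin.insertNth_succ_cons, Fin.insertNth_zero', word_cons,
      ← mul_assoc, ← pow_two, ← Finset.sum_mul, hy, one_mul]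
  | succ k ih =>
    refine Fin.cases ?_ (fun p => ?_) p
    · simp_rw [Fin.insertNth_zero', Fin.insertNth_succ_cons, Fin.insertNth_zero', word_cons,
        ← mul_assoc, ← pow_two, ← Finset.sum_mul, hy, one_mul]
    · rw [← Fin.cons_self_tail i]
      simp_rw [Fin.insertNth_succ_cons, word_cons, ← Finset.mul_sum, ih]

/-- The two letters are equal, so their order does not matter. This covers neighbouring strings that
cross. -/
theorem insertNth_castSucc_eq {α : Type*} {k : ℕ} (p : Fin (k + 1)) (t : α) (i : Fin k → α) :
    (Fin.insertNth p.castSucc t (Fin.insertNth p t i : Fin (k + 1) → α) : Fin (k + 2) → α) =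
      Fin.insertNth p.succ t (Fin.insertNth p t i : Fin (k + 1) → α) := by
  induction k with
  | zero =>
    obtain rfl : p = 0 := Subsingleton.elim (α := Fin 1) p 0
    simp_rw [Fin.castSucc_zero, Fin.insertNth_zero', Fin.insertNth_succ_cons, Fin.insertNth_zero']
  | succ k ih =>
    refine Fin.cases ?_ (fun p => ?_) p
    · simp_rw [Fin.castSucc_zero, Fin.insertNth_zero', Fin.insertNth_succ_cons,
        Fin.insertNth_zero']
    · rw [← Fin.cons_self_tail i]
      simp_rw [Fin.castSucc_succ, Fin.insertNth_succ_cons, ih]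

/-- Labels travel along strings: a letter `t` placed on the lower leg `τ p` appears at the upper leg
`p`. -/
theorem insertNth_apply_of_removesString {α : Type*} {k : ℕ} {p : Fin (k + 1)}
    {τ : Perm (Fin (k + 1))} {σ : Perm (Fin k)} (h : RemovesString p τ σ) (t : α)
    (i : Fin k → α) :
    (fun j => (Fin.insertNth (τ p) t i : Fin (k + 1) → α) (τ j)) =
      Fin.insertNth p t fun j => i (σ j) := by
  rw [Fin.eq_insertNth_iff]
  refine ⟨Fin.insertNth_apply_same _ _ _, funext fun j => ?_⟩
  simp only [Fin.removeNth]
  rw [h j, Fin.insertNth_apply_succAbove]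

theorem word_concat {k l : ℕ} (σ : Perm (Fin k)) (π : Perm (Fin l)) (i : Fin (k + l) → Fin N) :
    word y (fun j => i (concat σ π j)) =
      word y (fun j => i (Fin.castAdd l (σ j))) * word y fun j => i (Fin.natAdd k (π j)) := by
  rw [word_append]
  simp_rw [concat_castAdd, concat_natAdd]

/-- The filtered group of the permutations `σ` such that the `y i` satisfy the relations
associated to `σ`. -/
def relationGroup (hy : ∑ t, y t ^ 2 = 1) : FilteredSubgroup where
  level k :=
    { carrier := {σ | ∀ i : Fin k → Fin N, word y i = word y fun j => i (σ j)}
      mul_mem' := fun {σ π} hσ hπ i => (hσ i).trans (hπ fun j => i (σ j))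
      one_mem' := fun _ => rfl
      inv_mem' := fun {σ} hσ i => by
        rw [hσ fun j => i (σ⁻¹ j)]
        simp }
  mem_succ_iff {k} σ := by
    constructor
    · intro h i
      have key : ∀ t, word y i * y t = (word y fun j => i (σ j)) * y t := fun t => by
        have ht := h (Fin.snoc i t)
        rw [word_concat, word_append] at ht
        have h1 : ∀ j : Fin k, (Fin.snoc i t : Fin (k + 1) → Fin N) (Fin.castAdd 1 j) = i j :=
          fun j => Fin.snoc_castSucc (α := fun _ => Fin N) t i j
        have h2 : (Fin.snoc i t : Fin (k + 1) → Fin N) (Fin.natAdd k 0) = t :=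
          Fin.snoc_last (α := fun _ => Fin N) t i
        simpa only [h1, word_one, Perm.one_apply, h2] using ht
      -- Right cancellation of a letter: `a = ∑ a * y t * y t`.
      have key' : ∀ a b : R, (∀ t, a * y t = b * y t) → a = b := fun a b hab => by
        rw [← mul_one a, ← mul_one b, ← hy, Finset.mul_sum, Finset.mul_sum]
        refine Finset.sum_congr rfl fun t _ => ?_
        rw [pow_two, ← mul_assoc, hab, mul_assoc]
      exact key' _ _ key
    · intro h i
      rw [word_concat, word_append, ← h fun j => i (Fin.castAdd 1 j)]
      rfl
  concat_mem {k l σ π} hσ hπ i := by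
    rw [word_concat, word_append, ← hσ fun j => i (Fin.castAdd l j),
      ← hπ fun j => i (Fin.natAdd k j)]

theorem mem_relationGroup {hy : ∑ t, y t ^ 2 = 1} {k : ℕ} {σ : Perm (Fin k)} :
    σ ∈ (relationGroup hy).level k ↔ ∀ i, word y i = word y fun j => i (σ j) := Iff.rfl

theorem stableRemovingOuter_relationGroup (hy : ∑ t, y t ^ 2 = 1) :
    StableRemovingOuter (relationGroup hy) := by
  rintro k τ σ hτ (⟨h0, h⟩ | ⟨h0, h⟩)
  · intro i
    have key : ∀ t, y t * word y i = y t * word y fun j => i (σ j) := fun t => by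
      have ht := hτ (Fin.cons t i)
      have h1 : (fun j => (Fin.cons t i : Fin (k + 1) → Fin N) (τ j)) =
          Fin.cons t fun j => i (σ j) := by
        have := insertNth_apply_of_removesString h t i
        rwa [h0, Fin.insertNth_zero', Fin.insertNth_zero'] at this
      rwa [h1, word_cons, word_cons] at ht
    rw [← one_mul (word y i), ← one_mul (word y fun j => i (σ j)), ← hy, Finset.sum_mul,
      Finset.sum_mul]
    refine Finset.sum_congr rfl fun t _ => ?_
    rw [pow_two, mul_assoc, key, mul_assoc]
  -- Removing a right outer string is the converse of adding a fixed point at the right.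
  · refine ((relationGroup hy).mem_succ_iff σ).1 ?_
    have : concat σ 1 = τ := by
      ext j
      refine Fin.lastCases ?_ (fun j => ?_) j
      · rw [h0]
        exact congrArg Fin.val (concat_natAdd σ (1 : Perm (Fin 1)) 0)
      · have hj := h j
        rw [h0, Fin.succAbove_last] at hj
        rw [hj]
        exact congrArg Fin.val (concat_castAdd σ (1 : Perm (Fin 1)) j)
    rwa [this]

theorem stableRemovingNeighbours_relationGroup (hy : ∑ t, y t ^ 2 = 1) :
    StableRemovingNeighbours (relationGroup hy) := by
  intro k p τ ρ σ hτ hn hρ hσ i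
  -- The string at `p + 1` is deleted first, so the two lower legs of `τ` are `ρ p` and `ρ p + 1` in
  -- either order.
  have hq : τ p.succ = (ρ p).succ ∨ τ p.succ = (ρ p).castSucc := by
    have h1 := congrArg Fin.val (hρ p)
    rw [Fin.succAbove_succ_self] at h1
    have := val_succAbove_cases (τ p.succ) (ρ p)
    simp only [Fin.ext_iff, Fin.val_succ, Fin.val_castSucc]
    omega
  have hins : ∀ t : Fin N, (Fin.insertNth (τ p.succ) t
      (Fin.insertNth (ρ p) t i : Fin (k + 1) → Fin N) : Fin (k + 2) → Fin N) =
        Fin.insertNth (ρ p).succ t (Fin.insertNth (ρ p) t i : Fin (k + 1) → Fin N) := fun t => by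
    rcases hq with h | h
    · rw [h]
    · rw [h, insertNth_castSucc_eq]
  rw [← sum_word_insertNth hy (ρ p) i, ← sum_word_insertNth hy p]
  refine Finset.sum_congr rfl fun t _ => ?_
  rw [← hins, hτ, insertNth_apply_of_removesString hρ, insertNth_apply_of_removesString hσ]

end Word
-- Gelfand theory modulo a closed ideal of a C⋆-algebra
section Characters

/-- If `I` is a closed two-sided ideal of a complex Banach algebra with commutative quotient, then
every element which is not invertible modulo `I` is annihilated by a character vanishing on `I`. -/
theorem exists_character_of_not_isUnit_mk {A : Type*} [NormedRing A] [NormedAlgebra ℂ A]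
    [CompleteSpace A] (I : Ideal A) [I.IsTwoSided] (hI : IsClosed (I : Set A))
    (hcomm : ∀ a b : A, a * b - b * a ∈ I) {a : A} (ha : ¬IsUnit (Ideal.Quotient.mk I a)) :
    ∃ χ : A →ₐ[ℂ] ℂ, (∀ x ∈ I, χ x = 0) ∧ χ a = 0 := by
  let _ : NormedCommRing (A ⧸ I) :=
    { Submodule.Quotient.normedAddCommGroup I, Ideal.Quotient.ring I with
      mul_comm := by
        intro x y
        obtain ⟨x, rfl⟩ := Ideal.Quotient.mk_surjective x
        obtain ⟨y, rfl⟩ := Ideal.Quotient.mk_surjective y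
        rw [← map_mul, ← map_mul]
        exact Ideal.Quotient.eq.2 (hcomm x y)
      norm_mul_le := by
        intro x y
        -- The quotient norm is an infimum: multiply representatives that are optimal up to `ε`.
        refine le_of_forall_gt_imp_ge_of_dense fun r hr => ?_
        have hcont : Filter.Tendsto (fun ε : ℝ => (‖x‖ + ε) * (‖y‖ + ε)) (nhdsWithin 0 (Set.Ioi 0))
            (nhds (‖x‖ * ‖y‖)) := by
          have : Continuous fun ε : ℝ => (‖x‖ + ε) * (‖y‖ + ε) := by fun_prop
          simpa using (this.tendsto 0).mono_left nhdsWithin_le_nhds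
        obtain ⟨ε, hεr, hε⟩ :=
          ((hcont.eventually (gt_mem_nhds hr)).and self_mem_nhdsWithin).exists
        obtain ⟨a, rfl, ha⟩ := Submodule.Quotient.norm_mk_lt x (show (0 : ℝ) < ε from hε)
        obtain ⟨b, rfl, hb⟩ := Submodule.Quotient.norm_mk_lt y (show (0 : ℝ) < ε from hε)
        refine le_trans (le_trans (Submodule.Quotient.norm_mk_le I (a * b)) (norm_mul_le a b)) ?_
        exact (mul_le_mul ha.le hb.le (norm_nonneg _) ((norm_nonneg _).trans ha.le)).trans hεr.le }
  let _ : NormedAlgebra ℂ (A ⧸ I) :=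
    { Ideal.Quotient.algebra ℂ with
      norm_smul_le := (Submodule.Quotient.normedSpace I ℂ).norm_smul_le }
  have _ : CompleteSpace (A ⧸ I) := Submodule.Quotient.completeSpace I
  obtain ⟨f, hf⟩ := WeakDual.CharacterSpace.exists_apply_eq_zero ha
  let φ : A ⧸ I →ₐ[ℂ] ℂ := WeakDual.CharacterSpace.toAlgHom f
  refine ⟨φ.comp (Ideal.Quotient.mkₐ ℂ I), fun x hx => ?_, hf⟩
  rw [AlgHom.comp_apply, Ideal.Quotient.mkₐ_eq_mk, Ideal.Quotient.eq_zero_iff_mem.2 hx, map_zero]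

/-- In a C⋆-algebra, a closed two-sided ideal with commutative quotient contains the self-adjoint
elements which are annihilated by all the characters vanishing on it. -/
theorem mem_of_isSelfAdjoint_of_forall_character {A : Type*} [CStarAlgebra A]
    (I : Ideal A) [I.IsTwoSided] (hI : IsClosed (I : Set A))
    (hcomm : ∀ a b : A, a * b - b * a ∈ I) {a : A} (ha : IsSelfAdjoint a)
    (hχ : ∀ χ : A →ₐ[ℂ] ℂ, (∀ x ∈ I, χ x = 0) → χ a = 0) : a ∈ I := by
  -- This function vanishes on `[-ε, ε]`, where the tent `max 0 (1 - |t| / ε)` is supported, so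
  -- their product is zero. If its value at `a` were outside `I`, the tent of `a` would not be
  -- invertible modulo `I`, and some character vanishing on `I` would kill it. But that character
  -- kills `a`, so it sends the tent of `a` to the value `1` of the tent at `0`.
  have key : ∀ ε > 0, cfc (fun t : ℝ => t - max (-ε) (min t ε)) a ∈ I := fun ε hε => by
    by_contra hf
    have hmul : cfc (fun t : ℝ => max 0 (1 - |t| / ε)) a *
        cfc (fun t : ℝ => t - max (-ε) (min t ε)) a = 0 := by
      rw [← cfc_mul (fun t : ℝ => max 0 (1 - |t| / ε)) (fun t : ℝ => t - max (-ε) (min t ε)) a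
        (by fun_prop) (by fun_prop)]
      rw [show (fun t : ℝ => max 0 (1 - |t| / ε) * (t - max (-ε) (min t ε))) = fun _ => 0 from ?_,
        cfc_const_zero]
      funext t
      rcases le_total |t| ε with h | h
      · rw [min_eq_left (abs_le.1 h).2, max_eq_right (abs_le.1 h).1, sub_self, mul_zero]
      · rw [max_eq_left (sub_nonpos.2 ((one_le_div hε).2 h)), zero_mul]
    have hunit : ¬IsUnit (Ideal.Quotient.mk I (cfc (fun t : ℝ => max 0 (1 - |t| / ε)) a)) := by
      intro hu
      refine hf (Ideal.Quotient.eq_zero_iff_mem.1 (hu.mul_right_eq_zero.1 ?_))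
      rw [← map_mul, hmul, map_zero]
    obtain ⟨χ, h0, h1⟩ := exists_character_of_not_isUnit_mk I hI hcomm hunit
    have _ : StarHomClass (A →ₐ[ℂ] ℂ) A ℂ := AlgHomClass.instStarHomClass
    let ψ : A →⋆ₐ[ℂ] ℂ := { χ with map_star' := map_star χ }
    have hψ : ψ a = 0 := hχ χ h0
    have hmap := StarAlgHomClass.map_cfc ψ (fun t : ℝ => max 0 (1 - |t| / ε)) a (by fun_prop)
      (AddMonoidHomClass.continuous_of_bound ψ 1 fun x => by
        rw [one_mul]; exact NonUnitalStarAlgHom.norm_apply_le ψ x) ha (by rw [hψ]; exact .zero _)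
    rw [hψ, cfc_apply_zero, show ψ _ = 0 from h1] at hmap
    simp at hmap
  have hmem : a ∈ closure (I : Set A) := by
    refine Metric.mem_closure_iff.2 fun ε hε => ⟨_, key (ε / 2) (by positivity), ?_⟩
    have : a - cfc (fun t : ℝ => t - max (-(ε / 2)) (min t (ε / 2))) a =
        cfc (fun t : ℝ => max (-(ε / 2)) (min t (ε / 2))) a := by
      nth_rewrite 1 [← cfc_id ℝ a]
      rw [← cfc_sub id _ a (by fun_prop) (by fun_prop)]
      simp
    rw [dist_eq_norm, this]
    refine (norm_cfc_le (by positivity : 0 ≤ ε / 2) fun t _ => ?_).trans_lt (by linarith)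
    rw [Real.norm_eq_abs, abs_le]
    exact ⟨le_max_left _ _, max_le (by linarith) (min_le_right _ _)⟩
  rwa [hI.closure_eq] at hmem

end Characters

/-! ### The usual sphere -/

section RealSphere

variable {N : ℕ}

/-- The coordinates generate `C(S^{N-1}_{ℝ,+})` topologically. -/
theorem mem_of_forall_coord_mem {S : Subalgebra ℂ (FreeSphereAlg N)}
    (hS : IsClosed (S : Set (FreeSphereAlg N))) (h : ∀ i, coord i ∈ S) (a : FreeSphereAlg N) :
    a ∈ S := by
  have hadj : ∀ x ∈ StarAlgebra.adjoin ℂ (Set.range (universalCoord N)),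
      ∃ b ∈ S, (b : ModelProduct N) = x := by
    intro x hx
    let ι : FreeSphereAlg N →ₐ[ℂ] ModelProduct N := (StarSubalgebra.subtype _).toAlgHom
    have hle : Algebra.adjoin ℂ
        (Set.range (universalCoord N) ∪ star (Set.range (universalCoord N))) ≤ S.map ι := by
      refine Algebra.adjoin_le ?_
      rintro _ (⟨i, rfl⟩ | hi)
      · exact ⟨coord i, h i, rfl⟩
      · obtain ⟨i, hi⟩ := hi
        refine ⟨coord i, h i, ?_⟩
        rw [← star_coord i]
        exact (congrArg star hi).trans (star_star _)
    obtain ⟨b, hb, hbx⟩ := hle hx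
    exact ⟨b, hb, hbx⟩
  have hcl : a ∈ closure (S : Set (FreeSphereAlg N)) := by
    rw [Topology.IsInducing.subtypeVal.closure_eq_preimage_closure_image, Set.mem_preimage]
    refine closure_mono ?_ a.2
    intro x hx
    obtain ⟨b, hb, hbx⟩ := hadj x hx
    exact ⟨b, hb, hbx⟩
  rwa [hS.closure_eq] at hcl

/-- If the coordinates commute modulo a closed ideal, then all elements do. -/
theorem commutator_mem {I : TwoSidedIdeal (FreeSphereAlg N)}
    (hI : IsClosed (I : Set (FreeSphereAlg N)))
    (h : ∀ i j : Fin N, coord i * coord j - coord j * coord i ∈ I) (a b : FreeSphereAlg N) :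
    a * b - b * a ∈ I := by
  let S (b : FreeSphereAlg N) : Subalgebra ℂ (FreeSphereAlg N) :=
    (Subalgebra.centralizer ℂ {Ideal.Quotient.mkₐ ℂ I.asIdeal b}).comap
      (Ideal.Quotient.mkₐ ℂ I.asIdeal)
  have hmem : ∀ a b, a ∈ S b ↔ a * b - b * a ∈ I := fun a b => by
    rw [Subalgebra.mem_comap, Subalgebra.mem_centralizer_iff]
    simp only [Set.mem_singleton_iff, forall_eq]
    rw [← map_mul, ← map_mul, eq_comm, Ideal.Quotient.mkₐ_eq_mk, Ideal.Quotient.eq,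
      TwoSidedIdeal.mem_asIdeal]
  have hclosed : ∀ b, IsClosed (S b : Set (FreeSphereAlg N)) := fun b => by
    have : (S b : Set (FreeSphereAlg N)) = (fun a => a * b - b * a) ⁻¹' (I : Set _) := by
      ext a
      exact hmem a b
    rw [this]
    exact hI.preimage (by fun_prop)
  have hneg : ∀ a b, a * b - b * a ∈ I → b * a - a * b ∈ I := fun a b hab => by
    rw [← neg_sub]
    exact I.neg_mem hab
  -- The elements commuting with a given one modulo `I` form a closed subalgebra. Density of the
  -- coordinates is used twice, once in each variable.
  refine (hmem a b).1 (mem_of_forall_coord_mem (hclosed b) (fun i => (hmem _ _).2 ?_) a)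
  refine hneg _ _ ((hmem _ _).1 (mem_of_forall_coord_mem (hclosed _) (fun j => ?_) b))
  exact (hmem _ _).2 (h j i)

/-- The characters of `C(S^{N-1}_{ℝ,+})` are the points of the usual sphere. -/
theorem exists_realPoint (χ : FreeSphereAlg N →ₐ[ℂ] ℂ) :
    ∃ p : RealPoint N, ∀ a, χ a = evalModel (pointModel p) a := by
  have _ : StarHomClass (FreeSphereAlg N →ₐ[ℂ] ℂ) (FreeSphereAlg N) ℂ :=
    AlgHomClass.instStarHomClass
  have hre : ∀ i, ((χ (coord i)).re : ℂ) = χ (coord i) := fun i => by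
    refine Complex.conj_eq_iff_re.1 ?_
    have := map_star χ (coord i)
    rw [star_coord] at this
    exact this.symm
  have hsum : ∑ i, (χ (coord i)).re ^ 2 = 1 := by
    have : ∑ i, ((χ (coord i)).re : ℂ) ^ 2 = 1 := by
      rw [← map_one χ, ← sum_coord_sq, map_sum]
      exact Finset.sum_congr rfl fun i _ => by rw [hre, map_pow]
    exact_mod_cast this
  refine ⟨⟨fun i => (χ (coord i)).re, hsum⟩, fun a => ?_⟩
  let ψ : FreeSphereAlg N →⋆ₐ[ℂ] ℂ := { χ with map_star' := map_star χ }
  exact DFunLike.congr_fun (eq_evalModel (pointModel ⟨fun i => (χ (coord i)).re, hsum⟩) ψ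
    fun i => (hre i).symm) a

theorem mem_realSphere {a : FreeSphereAlg N} :
    a ∈ (realSphere N).ideal ↔ ∀ p : RealPoint N, evalModel (pointModel p) a = 0 :=
  (TwoSidedIdeal.mem_iInf _).trans
    (forall_congr' fun p => TwoSidedIdeal.mem_ker (evalModel (pointModel p)))

/-- A closed ideal modulo which the coordinates commute contains all the elements vanishing on the
usual sphere. -/
theorem realSphere_ideal_le {I : TwoSidedIdeal (FreeSphereAlg N)}
    (hI : IsClosed (I : Set (FreeSphereAlg N)))
    (h : ∀ i j : Fin N, coord i * coord j - coord j * coord i ∈ I) :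
    (realSphere N).ideal ≤ I := by
  have key : ∀ a, IsSelfAdjoint a → a ∈ (realSphere N).ideal → a ∈ I := fun a ha haR => by
    rw [← TwoSidedIdeal.mem_asIdeal]
    refine mem_of_isSelfAdjoint_of_forall_character I.asIdeal hI (commutator_mem hI h) ha ?_
    intro χ _
    obtain ⟨p, hp⟩ := exists_realPoint χ
    rw [hp]
    exact mem_realSphere.1 haR p
  have hsmul : ∀ (c : ℂ) (x : FreeSphereAlg N), x ∈ I → c • x ∈ I := fun c x hx => by
    rw [Algebra.smul_def]
    exact I.mul_mem_left _ _ hx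
  intro a ha
  have hev := mem_realSphere.1 ha
  have h1 : (realPart a : FreeSphereAlg N) ∈ I := by
    refine key _ (realPart a).2 (mem_realSphere.2 fun p => ?_)
    rw [realPart_apply_coe, ← Complex.coe_smul, map_smul, map_add, map_star, hev p,
      star_zero, add_zero, smul_zero]
  have h2 : (imaginaryPart a : FreeSphereAlg N) ∈ I := by
    refine key _ (imaginaryPart a).2 (mem_realSphere.2 fun p => ?_)
    rw [imaginaryPart_apply_coe, map_smul, ← Complex.coe_smul, map_smul, map_sub, map_star,
      hev p, star_zero, sub_zero, smul_zero, smul_zero]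
  rw [← realPart_add_I_smul_imaginaryPart a]
  exact I.add_mem h1 (hsmul _ _ h2)

end RealSphere
/-! ### Monomial spheres -/

section Sphere

variable {N : ℕ}

theorem mem_cutOut {R : Set (FreeSphereAlg N × FreeSphereAlg N)}
    {r : FreeSphereAlg N × FreeSphereAlg N} (hr : r ∈ R) : r.1 - r.2 ∈ (cutOut R).ideal :=
  (TwoSidedIdeal.mem_sInf _).2 fun _ hI => hI.2 r hr

theorem cutOut_ideal_le {R : Set (FreeSphereAlg N × FreeSphereAlg N)} {S : ClosedSubspace N}
    (h : ∀ r ∈ R, r.1 - r.2 ∈ S.ideal) : (cutOut R).ideal ≤ S.ideal :=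
  fun _ ha => (TwoSidedIdeal.mem_sInf _).1 ha _ ⟨S.isClosed, h⟩

/-- The coordinates on a closed subspace of the free sphere, as elements of the quotient. -/
noncomputable def quotientCoord (S : ClosedSubspace N) (t : Fin N) :
    FreeSphereAlg N ⧸ S.ideal.asIdeal :=
  Ideal.Quotient.mk S.ideal.asIdeal (coord t)

theorem sum_quotientCoord_sq (S : ClosedSubspace N) : ∑ t, quotientCoord S t ^ 2 = 1 := by
  rw [← map_one (Ideal.Quotient.mk S.ideal.asIdeal), ← sum_coord_sq, map_sum]
  exact Finset.sum_congr rfl fun t _ => (map_pow _ _ _).symm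

theorem word_quotientCoord (S : ClosedSubspace N) {k : ℕ} (i : Fin k → Fin N) :
    word (quotientCoord S) i = Ideal.Quotient.mk S.ideal.asIdeal (monomial i) := by
  rw [monomial, map_list_prod, List.map_ofFn]
  rfl

/-- The filtered group of the permutations whose relations hold on a closed subspace. -/
noncomputable def sphereGroup (S : ClosedSubspace N) : FilteredSubgroup :=
  relationGroup (sum_quotientCoord_sq S)

theorem mem_sphereGroup {S : ClosedSubspace N} {k : ℕ} {σ : Perm (Fin k)} :
    σ ∈ (sphereGroup S).level k ↔ ∀ r ∈ permRelations N σ, r.1 - r.2 ∈ S.ideal := by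
  refine mem_relationGroup.trans ⟨?_, fun h i => ?_⟩
  · rintro h _ ⟨i, rfl⟩
    have := h i
    rwa [word_quotientCoord, word_quotientCoord, Ideal.Quotient.eq] at this
  · rw [word_quotientCoord, word_quotientCoord, Ideal.Quotient.eq]
    exact h _ ⟨i, rfl⟩

/-- The bridge between the two halves of the theorem. -/
theorem sphereGroup_cases (S : ClosedSubspace N) :
    sphereGroup S = trivialGroup ∨ sphereGroup S = parityGroup ∨ sphereGroup S = fullGroup :=
  (stable_iff _).1 ⟨stableRemovingOuter_relationGroup _, stableRemovingNeighbours_relationGroup _⟩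

theorem mem_sphereGroup_cutOut {k : ℕ} (σ : Perm (Fin k)) :
    σ ∈ (sphereGroup (cutOut (permRelations N σ))).level k :=
  mem_sphereGroup.2 fun _ => mem_cutOut

theorem cutOut_permRelations_le {k : ℕ} {σ : Perm (Fin k)} {S : ClosedSubspace N}
    (h : σ ∈ (sphereGroup S).level k) : (cutOut (permRelations N σ)).ideal ≤ S.ideal :=
  cutOut_ideal_le (mem_sphereGroup.1 h)

theorem monomial_two (i : Fin 2 → Fin N) : monomial i = coord (i 0) * coord (i 1) := by
  simp [monomial, List.ofFn_succ]

theorem monomial_three (i : Fin 3 → Fin N) :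
    monomial i = coord (i 0) * coord (i 1) * coord (i 2) := by
  simp [monomial, List.ofFn_succ, mul_assoc]

theorem halfLiberatedSphere_eq_cutOut :
    halfLiberatedSphere N = cutOut (permRelations N (swap (0 : Fin 3) 2)) := by
  refine congrArg cutOut (Set.ext fun r => ⟨?_, ?_⟩)
  · rintro ⟨i, j, k, rfl⟩
    exact ⟨![i, j, k], by rw [monomial_three, monomial_three]; rfl⟩
  · rintro ⟨i, rfl⟩
    exact ⟨i 0, i 1, i 2, by rw [monomial_three, monomial_three]; rfl⟩

/-- The nontrivial inclusion, that commutation imposes everything vanishing on the real sphere, is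
the Gelfand argument. -/
theorem realSphere_eq_cutOut :
    realSphere N = cutOut (permRelations N (swap (0 : Fin 2) 1)) := by
  refine ClosedSubspace.ext (le_antisymm ?_ ?_)
  · refine realSphere_ideal_le (cutOut _).isClosed fun i j => ?_
    refine mem_cutOut (r := (coord i * coord j, coord j * coord i)) ⟨![i, j], ?_⟩
    rw [monomial_two, monomial_two]
    rfl
  · refine cutOut_ideal_le ?_
    rintro _ ⟨i, rfl⟩
    rw [monomial_two, monomial_two]
    refine mem_realSphere.2 fun p => ?_
    rw [map_sub, map_mul, map_mul, sub_eq_zero]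
    exact mul_comm (G := ℂ) _ _

theorem isMonomialSphere_cutOut {k : ℕ} (σ : Perm (Fin k)) :
    IsMonomialSphere (cutOut (permRelations N σ)) :=
  ⟨{⟨k, σ⟩}, by rw [Set.biUnion_singleton]⟩

theorem isMonomialSphere_freeSphere : IsMonomialSphere (freeSphere N) := by
  refine ⟨∅, ClosedSubspace.ext (le_antisymm bot_le (cutOut_ideal_le ?_))⟩
  simp

theorem swap_zero_one_notMem_parityGroup : swap (0 : Fin 2) 1 ∉ parityGroup.level 2 :=
  fun h => absurd (h 0) (by decide)

theorem swap_zero_one_notMem_trivialGroup : swap (0 : Fin 2) 1 ∉ trivialGroup.level 2 :=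
  fun h => absurd (show swap (0 : Fin 2) 1 = 1 from h) (by decide)

theorem swap_zero_two_notMem_trivialGroup : swap (0 : Fin 3) 2 ∉ trivialGroup.level 3 :=
  fun h => absurd (show swap (0 : Fin 3) 2 = 1 from h) (by decide)

theorem swap_zero_two_mem_parityGroup : swap (0 : Fin 3) 2 ∈ parityGroup.level 3 :=
  show ∀ i : Fin 3, (swap (0 : Fin 3) 2 i).val % 2 = i.val % 2 by decide

theorem sphereGroup_realSphere : sphereGroup (realSphere N) = fullGroup := by
  have h := mem_sphereGroup_cutOut (N := N) (swap (0 : Fin 2) 1)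
  rw [← realSphere_eq_cutOut] at h
  rcases sphereGroup_cases (realSphere N) with h' | h' | h'
  · exact absurd (h' ▸ h) swap_zero_one_notMem_trivialGroup
  · exact absurd (h' ▸ h) swap_zero_one_notMem_parityGroup
  · exact h'

/-- Only an inclusion: for `N ≤ 1` the algebra is commutative and the group is all of `S_∞`. -/
theorem parityGroup_le_sphereGroup_halfLiberatedSphere {k : ℕ} {σ : Perm (Fin k)}
    (hσ : σ ∈ parityGroup.level k) : σ ∈ (sphereGroup (halfLiberatedSphere N)).level k := by
  have h := mem_sphereGroup_cutOut (N := N) (swap (0 : Fin 3) 2)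
  rw [← halfLiberatedSphere_eq_cutOut] at h
  rcases sphereGroup_cases (halfLiberatedSphere N) with h' | h' | h'
  · exact absurd (h' ▸ h) swap_zero_two_notMem_trivialGroup
  · rwa [h']
  · rw [h']
    exact Subgroup.mem_top σ

theorem isMonomialSphere_iff (S : ClosedSubspace N) :
    IsMonomialSphere S ↔ S = realSphere N ∨ S = halfLiberatedSphere N ∨ S = freeSphere N := by
  constructor
  · rintro ⟨E, rfl⟩
    set S : ClosedSubspace N := cutOut (⋃ σ ∈ E, permRelations N σ.2) with hS
    have hE : ∀ σ ∈ E, σ.2 ∈ (sphereGroup S).level σ.1 := fun σ hσ =>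
      mem_sphereGroup.2 fun r hr => mem_cutOut (Set.mem_biUnion hσ hr)
    have hle : ∀ T : ClosedSubspace N, (∀ σ ∈ E, σ.2 ∈ (sphereGroup T).level σ.1) →
        S.ideal ≤ T.ideal := fun T hT => cutOut_ideal_le fun r hr => by
      obtain ⟨σ, hσ, hr⟩ := Set.mem_iUnion₂.1 hr
      exact mem_sphereGroup.1 (hT σ hσ) r hr
    -- In each case `E` lies in the group of the candidate sphere, which bounds the ideal of `S`
    -- above. The lower bound is trivial or comes from the defining transposition, which belongs to
    -- the group of `S`.
    rcases sphereGroup_cases S with h | h | h <;> rw [h] at hE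
    · refine Or.inr (Or.inr (ClosedSubspace.ext (le_antisymm (hle _ fun σ hσ => ?_) bot_le)))
      rw [show σ.2 = 1 from hE σ hσ]
      exact one_mem _
    · refine Or.inr (Or.inl (ClosedSubspace.ext (le_antisymm (hle _ fun σ hσ => ?_) ?_)))
      · exact parityGroup_le_sphereGroup_halfLiberatedSphere (hE σ hσ)
      · rw [halfLiberatedSphere_eq_cutOut]
        exact cutOut_permRelations_le (h ▸ swap_zero_two_mem_parityGroup)
    · refine Or.inl (ClosedSubspace.ext (le_antisymm (hle _ fun σ hσ => ?_) ?_))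
      · rw [sphereGroup_realSphere]
        exact Subgroup.mem_top σ.2
      · rw [realSphere_eq_cutOut]
        exact cutOut_permRelations_le (h ▸ Subgroup.mem_top _)
  · rintro (rfl | rfl | rfl)
    · rw [realSphere_eq_cutOut]
      exact isMonomialSphere_cutOut _
    · rw [halfLiberatedSphere_eq_cutOut]
      exact isMonomialSphere_cutOut _
    · exact isMonomialSphere_freeSphere

end Sphere
end MonomialSphere

theorem theorem2p8 :
    (∀ (N : ℕ) (S : MonomialSphere.ClosedSubspace N),
      MonomialSphere.IsMonomialSphere S ↔
        S = MonomialSphere.realSphere N ∨ S = MonomialSphere.halfLiberatedSphere N ∨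
          S = MonomialSphere.freeSphere N) ∧
    (∀ G : MonomialSphere.FilteredSubgroup,
      (MonomialSphere.StableRemovingOuter G ∧ MonomialSphere.StableRemovingNeighbours G) ↔
        G = MonomialSphere.trivialGroup ∨ G = MonomialSphere.parityGroup ∨
          G = MonomialSphere.fullGroup) :=
  ⟨fun _ S => MonomialSphere.isMonomialSphere_iff S, MonomialSphere.stable_iff⟩
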